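/- Let $d\ge 1$ and $1\le i\le k$ be integers. For an integer $n\ge 0$, let $A_{d,k,i}(n)$ denote the number of partitions of $n$ into parts $\not\equiv 0,\pm di \pmod{2dk+d}$, and let $B_{d,k,i}(n)$ denote the number of partitions of $n$ in which - the integer $d$ appears as a part at most $i-1$ times, - for every integer $j\ge 1$, the total number of appearances of $dj$ and $dj+d$ (that is, of any two consecutive positive multiples of $d$) together is at most $k-1$, and - parts that are not multiples of $d$ may appear without restriction. Then $A_{d,k,i}(n)=B_{d,k,i}(n)$ for all $n\ge 0$. (The case $d=1$ is Gordon's partition theorem.) -/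

import Mathlib

/-- `A_{d,k,i}(n)`: the number of partitions of `n` into parts not congruent to
`0`, `d * i` or `-(d * i)` modulo `2 * d * k + d`. -/
def numA (d k i n : ℕ) : ℕ :=
  (Nat.Partition.restricted n fun p : ℕ =>
    ¬ (p : ℤ) ≡ 0 [ZMOD 2 * d * k + d] ∧
    ¬ (p : ℤ) ≡ (d : ℤ) * i [ZMOD 2 * d * k + d] ∧
    ¬ (p : ℤ) ≡ -((d : ℤ) * i) [ZMOD 2 * d * k + d]).card

/-- The partition `π` contains the part `d` at most `i - 1` times, and for all `j ≥ 1` the total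
number of appearances of `d * j` and `d * j + d` in `π` is at most `k - 1`; parts that are not
multiples of `d` are unrestricted. -/
def IsGordonPartition (d k i : ℕ) {n : ℕ} (π : n.Partition) : Prop :=
  π.parts.count d ≤ i - 1 ∧
  ∀ j : ℕ, 1 ≤ j → π.parts.count (d * j) + π.parts.count (d * j + d) ≤ k - 1

open Classical in
/-- `B_{d,k,i}(n)`: the number of partitions of `n` satisfying `IsGordonPartition d k i`. -/
noncomputable def numB (d k i n : ℕ) : ℕ :=
  (Finset.univ.filter fun π : n.Partition => IsGordonPartition d k i π).card

/-!
Everything about multiples of `d` happens in the variable `q = X ^ d`; the parts that are not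
multiples of `d` contribute the same factor to both sides. So the proof is Andrews' analytic proof
of Gordon's theorem, with `q = X ^ d` and that factor carried along.

Let `F m i` be the generating function of the partitions that satisfy the Gordon conditions, contain
none of `d, 2 * d, …, m * d`, and contain `(m + 1) * d` fewer than `i` times. Sorting by whether
`(m + 1) * d` occurs exactly `i` times gives
`F m (i + 1) = F m i + q ^ ((m + 1) * i) * F (m + 1) (k - i)`
(`partitionGenFun_isGordonAbove_succ`). The index `m` takes the place of the second variable
`x = q ^ m` of the classical proof. The Rogers–Selberg series satisfy the same recurrence up to the
factor `1 - q ^ (m + 1)` (`rogersSelberg_succ`), and modulo `q ^ (N + 1)` the values at `m = N`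
are known, so `F m i` is determined (`mul_prod_eq_mul_rogersSelberg`). At `m = 0` the
Rogers–Selberg series is a theta series, which Jacobi's triple product turns into the product of
`1 - X ^ a` over the excluded parts `a` (`rogersSelberg_zero_eq_eulerProd`). Hence the generating
function of the Gordon-type partitions, multiplied by the product of `1 - X ^ a` over the admitted
parts, is `1`, and the same is true of the generating function of the partitions into admitted
parts.

Convergence is avoided by working in the quotient `ℤ⟦X⟧ ⧸ (X ^ (N + 1))`, where all sums and
products are finite and every `1 - q ^ j` with `j ≥ 1` is a unit. The triple product is first proved
as a finite identity in the domain `ℤ⟦X⟧` from the `q`-binomial theorem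
(`finite_jacobi_triple_product`) and then reduced.
-/

open Finset

/-! ### Gaussian binomial coefficients and the `q`-binomial theorem -/

section GaussianBinomials

variable {R : Type*} [CommRing R]

/-- The `q`-factorial product `(1 - q)(1 - q ^ 2) ⋯ (1 - q ^ n)`. -/
def qPoch (q : R) (n : ℕ) : R := ∏ j ∈ range n, (1 - q ^ (j + 1))

/-- The Gaussian binomial coefficient `[m + n choose n]_q`, in the form symmetric in `m` and `n`,
given by the `q`-Pascal rule so that it makes sense for an element `q` of any ring. -/
def gaussBinom (q : R) : ℕ → ℕ → R
  | 0, _ => 1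
  | _ + 1, 0 => 1
  | m + 1, n + 1 => gaussBinom q (m + 1) n + q ^ (n + 1) * gaussBinom q m (n + 1)

@[simp]
lemma gaussBinom_zero_left (q : R) (n : ℕ) : gaussBinom q 0 n = 1 := by
  simp [gaussBinom]

@[simp]
lemma gaussBinom_zero_right (q : R) (m : ℕ) : gaussBinom q m 0 = 1 := by
  cases m <;> simp [gaussBinom]

lemma gaussBinom_succ_succ (q : R) (m n : ℕ) :
    gaussBinom q (m + 1) (n + 1) =
      gaussBinom q (m + 1) n + q ^ (n + 1) * gaussBinom q m (n + 1) := by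
  simp [gaussBinom]

lemma map_gaussBinom {S : Type*} [CommRing S] (φ : R →+* S) (q : R) (m n : ℕ) :
    φ (gaussBinom q m n) = gaussBinom (φ q) m n := by
  induction m generalizing n with
  | zero => simp
  | succ m ihm =>
    induction n with
    | zero => simp
    | succ n ihn => simp [gaussBinom_succ_succ, ihm, ihn]

lemma qPoch_succ (q : R) (n : ℕ) : qPoch q (n + 1) = qPoch q n * (1 - q ^ (n + 1)) :=
  prod_range_succ _ _

@[simp]
lemma qPoch_zero (q : R) : qPoch q 0 = 1 := prod_range_zero _

lemma gaussBinom_mul_qPoch (q : R) (m n : ℕ) :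
    gaussBinom q m n * qPoch q m * qPoch q n = qPoch q (m + n) := by
  induction m generalizing n with
  | zero => simp
  | succ m ihm =>
    induction n with
    | zero => simp
    | succ n ihn =>
      have h1 := ihm (n + 1)
      have e1 : qPoch q (m + (n + 1)) = qPoch q (m + n + 1) := rfl
      have e2 : qPoch q (m + 1 + n) = qPoch q (m + n + 1) := by congr 1; ring
      have e3 : qPoch q (m + 1 + (n + 1)) = qPoch q (m + n + 1) * (1 - q ^ (m + n + 2)) := by
        rw [← qPoch_succ]; congr 1; ring
      rw [e1] at h1
      rw [e2] at ihn
      rw [e3, gaussBinom_succ_succ]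
      rw [qPoch_succ q n] at h1 ⊢
      rw [qPoch_succ q m] at ihn ⊢
      linear_combination (1 - q ^ (n + 1)) * ihn + q ^ (n + 1) * (1 - q ^ (m + 1)) * h1

lemma isUnit_qPoch {q : R} (hq : IsNilpotent q) (n : ℕ) : IsUnit (qPoch q n) :=
  (IsUnit.prod_iff).2 fun j _ => (hq.pow_of_pos (Nat.succ_ne_zero j)).isUnit_one_sub

lemma one_sub_mul_gaussBinom_succ_left {q : R} (hq : IsNilpotent q) (m n : ℕ) :
    (1 - q ^ (m + 1)) * gaussBinom q (m + 1) n = (1 - q ^ (m + n + 1)) * gaussBinom q m n := by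
  apply ((isUnit_qPoch hq m).mul (isUnit_qPoch hq n)).mul_right_cancel
  have h1 := gaussBinom_mul_qPoch q (m + 1) n
  have h2 := gaussBinom_mul_qPoch q m n
  rw [show m + 1 + n = m + n + 1 by ring, qPoch_succ, qPoch_succ] at h1
  linear_combination h1 - (1 - q ^ (m + n + 1)) * h2

lemma one_sub_mul_gaussBinom_succ_right {q : R} (hq : IsNilpotent q) (m n : ℕ) :
    (1 - q ^ (n + 1)) * gaussBinom q m (n + 1) = (1 - q ^ (m + n + 1)) * gaussBinom q m n := by
  apply ((isUnit_qPoch hq m).mul (isUnit_qPoch hq n)).mul_right_cancel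
  have h1 := gaussBinom_mul_qPoch q m (n + 1)
  have h2 := gaussBinom_mul_qPoch q m n
  rw [show m + (n + 1) = m + n + 1 by ring, qPoch_succ, qPoch_succ] at h1
  linear_combination h1 - (1 - q ^ (m + n + 1)) * h2

lemma mul_qPoch_eq_of_mul_pow_eq_zero {c q : R} {e L : ℕ} (hc : c * q ^ (e + 1) = 0)
    (heL : e ≤ L) : c * qPoch q L = c * qPoch q e := by
  induction L, heL using Nat.le_induction with
  | base => rfl
  | succ L heL ih =>
    obtain ⟨r, rfl⟩ := Nat.exists_eq_add_of_le heL
    rw [qPoch_succ, ← ih]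
    linear_combination -(qPoch q (e + r) * q ^ r) * hc

/-- Modulo `q ^ (min m n + 1)`, the Gaussian binomial `[m + n choose n]_q` is the inverse of the
Euler product `(1 - q)(1 - q ^ 2) ⋯`. The congruence is expressed by a factor `c` that is killed by
`q ^ (e + 1)`. -/
lemma mul_gaussBinom_mul_qPoch_eq {c q : R} (hq : IsNilpotent q) {m n e L : ℕ}
    (hm : e ≤ m) (hn : e ≤ n) (hL : e ≤ L) (hc : c * q ^ (e + 1) = 0) :
    c * (gaussBinom q m n * qPoch q L) = c := by
  have key : c * (gaussBinom q m n * qPoch q e) = c := by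
    apply (isUnit_qPoch hq e).mul_right_cancel
    have h1 := mul_qPoch_eq_of_mul_pow_eq_zero (q := q) (c := c * gaussBinom q m n * qPoch q m)
      (by linear_combination gaussBinom q m n * qPoch q m * hc) hn
    have h2 := mul_qPoch_eq_of_mul_pow_eq_zero (q := q) (c := c * gaussBinom q m n * qPoch q e)
      (by linear_combination gaussBinom q m n * qPoch q e * hc) hm
    have h3 := mul_qPoch_eq_of_mul_pow_eq_zero hc (show e ≤ m + n by omega)
    have h4 := gaussBinom_mul_qPoch q m n
    linear_combination -h1 - h2 + h3 + c * h4
  have h5 := mul_qPoch_eq_of_mul_pow_eq_zero (q := q) (c := c * gaussBinom q m n)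
      (by linear_combination gaussBinom q m n * hc) hL
  linear_combination h5 + key

/-- The homogeneous `q`-binomial theorem. -/
theorem prod_add_mul_pow_eq_sum_gaussBinom (q a b : R) (N : ℕ) :
    ∏ j ∈ range N, (a + b * q ^ j) =
      ∑ p ∈ antidiagonal N, q ^ p.2.choose 2 * gaussBinom q p.1 p.2 * b ^ p.2 * a ^ p.1 := by
  induction N generalizing b with
  | zero => simp
  | succ N ih =>
    have h0 : ∏ j ∈ range (N + 1), (a + b * q ^ j) =
        (a + b) * ∏ j ∈ range N, (a + (b * q) * q ^ j) := by
      rw [prod_range_succ', mul_comm]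
      congr 1
      · simp
      · exact prod_congr rfl fun j _ => by ring
    rw [h0, ih, add_mul, mul_sum, mul_sum]
    cases N with
    | zero => simp [Finset.Nat.antidiagonal_succ]; ring
    | succ N =>
      rw [← mul_sum, ← mul_sum]
      nth_rw 1 [Finset.Nat.sum_antidiagonal_succ' (n := N)]
      rw [
        Finset.Nat.sum_antidiagonal_succ (n := N),
        Finset.Nat.sum_antidiagonal_succ (n := N + 1),
        Finset.Nat.sum_antidiagonal_succ' (n := N)]
      simp only [gaussBinom_succ_succ, gaussBinom_zero_left, gaussBinom_zero_right]
      have e : ∀ n : ℕ, (n + 1).choose 2 = n.choose 2 + n := fun n => by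
        rw [Nat.choose_succ_succ' n 1, Nat.choose_one_right, add_comm]
      have h2 : ∀ p ∈ antidiagonal N,
          q ^ (p.2 + 1).choose 2 * (gaussBinom q (p.1 + 1) p.2 +
            q ^ (p.2 + 1) * gaussBinom q p.1 (p.2 + 1)) * b ^ (p.2 + 1) * a ^ (p.1 + 1) =
          a * (q ^ (p.2 + 1).choose 2 * gaussBinom q p.1 (p.2 + 1) * (b * q) ^ (p.2 + 1)
            * a ^ p.1) +
          b * (q ^ p.2.choose 2 * gaussBinom q (p.1 + 1) p.2 * (b * q) ^ p.2 * a ^ (p.1 + 1)) := by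
        intro p _
        rw [e p.2]
        ring
      rw [sum_congr rfl h2, sum_add_distrib, ← mul_sum, ← mul_sum]
      simp only [e]
      simp
      ring

end GaussianBinomials

/-! ### Jacobi's triple product -/

section JacobiTripleProduct

variable {R : Type*} [CommRing R]

lemma two_mul_choose_two_add (n : ℕ) : 2 * n.choose 2 + n = n ^ 2 := by
  induction n with
  | zero => simp
  | succ n ih =>
    rw [Nat.choose_succ_succ' n 1, Nat.choose_one_right]
    linarith

lemma choose_two_add (a b : ℕ) : (a + b).choose 2 = a.choose 2 + b.choose 2 + a * b := by
  have h1 := two_mul_choose_two_add a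
  have h2 := two_mul_choose_two_add b
  have h3 := two_mul_choose_two_add (a + b)
  linarith

lemma prod_pow_range (q : R) (n : ℕ) : ∏ j ∈ range n, q ^ j = q ^ n.choose 2 := by
  rw [prod_pow_eq_pow_sum, sum_range_id, Nat.choose_two_right]

/-- The finite form of Jacobi's triple product identity, in the two variables `u` and `v` with
`u * v = Q`. -/
theorem finite_jacobi_triple_product [IsDomain R] {Q u v : R} (huv : u * v = Q) (hQ : Q ≠ 0)
    (N : ℕ) :
    (∏ j ∈ range N, (1 - u * Q ^ j)) * ∏ j ∈ range N, (1 - v * Q ^ j) =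
      ∑ n ∈ range (N + 1),
        (-1) ^ n * Q ^ n.choose 2 * v ^ n * gaussBinom Q (N + n) (N - n) +
      ∑ n ∈ range N,
        (-1) ^ (n + 1) * Q ^ (n + 1).choose 2 * u ^ (n + 1) *
          gaussBinom Q (N - (n + 1)) (N + (n + 1)) := by
  have hu : u ≠ 0 := by
    rintro rfl
    simp [← huv] at hQ
  have hc : (-u) ^ N * Q ^ (N.choose 2 + N ^ 2) ≠ 0 :=
    mul_ne_zero (pow_ne_zero _ (neg_ne_zero.2 hu)) (pow_ne_zero _ hQ)
  apply mul_left_cancel₀ hc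
  -- Both sides are now two evaluations of `∏ j < 2 * N, (Q ^ N - u * Q ^ j)`.
  have hprod : ∏ j ∈ range (N + N), (Q ^ N + (-u) * Q ^ j) =
      (-u) ^ N * Q ^ (N.choose 2 + N ^ 2) *
        ((∏ j ∈ range N, (1 - u * Q ^ j)) * ∏ j ∈ range N, (1 - v * Q ^ j)) := by
    rw [prod_range_add]
    have h1 : ∏ j ∈ range N, (Q ^ N + (-u) * Q ^ j) =
        (-u) ^ N * Q ^ N.choose 2 * ∏ j ∈ range N, (1 - v * Q ^ j) := by
      rw [← prod_range_reflect (fun j => 1 - v * Q ^ j), ← prod_pow_range]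
      have : (-u) ^ N = ∏ j ∈ range N, (-u) := by simp
      rw [this, ← prod_mul_distrib, ← prod_mul_distrib]
      refine prod_congr rfl fun j hj => ?_
      obtain ⟨s, rfl⟩ := Nat.exists_eq_add_of_lt (mem_range.1 hj)
      rw [show j + s + 1 - 1 - j = s by omega]
      rw [show Q ^ (j + s + 1) = u * v * Q ^ j * Q ^ s by rw [huv]; ring]
      ring
    have h2 : ∏ j ∈ range N, (Q ^ N + (-u) * Q ^ (N + j)) =
        Q ^ N ^ 2 * ∏ j ∈ range N, (1 - u * Q ^ j) := by
      have : Q ^ N ^ 2 = ∏ j ∈ range N, Q ^ N := by simp [sq, pow_mul]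
      rw [this, ← prod_mul_distrib]
      exact prod_congr rfl fun j _ => by ring
    rw [h1, h2]
    ring
  rw [← hprod, prod_add_mul_pow_eq_sum_gaussBinom,
    Finset.Nat.sum_antidiagonal_eq_sum_range_succ_mk, Nat.succ_eq_add_one, add_assoc,
    sum_range_add, mul_add, add_comm, mul_sum, mul_sum]
  congr 1
  · refine sum_congr rfl fun n hn => ?_
    obtain ⟨s, rfl⟩ := Nat.exists_eq_add_of_le (Nat.lt_succ_iff.1 (mem_range.1 hn))
    simp only [show n + s + (n + s) - (n + s + n) = s by omega, show n + s - n = s by omega]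
    have e : Q ^ (s.choose 2 + (n + s) * (n + s + n)) =
        Q ^ ((n + s).choose 2 + (n + s) ^ 2 + n.choose 2) * (u * v) ^ n := by
      rw [huv, ← pow_add]
      congr 1
      have h1 := choose_two_add n s
      have h2 := two_mul_choose_two_add n
      linarith
    have e2 : (-u) ^ (n + s) * (-1) ^ n = (-u) ^ s * u ^ n := by
      rw [pow_add, mul_right_comm, ← mul_pow]
      ring
    rw [← pow_mul]
    linear_combination (gaussBinom Q (n + s + n) s * (-u) ^ s) * e -
      gaussBinom Q (n + s + n) s * Q ^ ((n + s).choose 2 + (n + s) ^ 2 + n.choose 2) * v ^ n * e2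
  · rw [← sum_range_reflect]
    refine sum_congr rfl fun n hn => ?_
    obtain ⟨s, rfl⟩ := Nat.exists_eq_add_of_lt (mem_range.1 hn)
    simp only [show n + s + 1 - 1 - n = s by omega,
      show n + s + 1 + (n + s + 1) - s = n + s + 1 + (n + 1) by omega,
      show n + s + 1 - (n + 1) = s by omega]
    have e : Q ^ ((n + s + 1 + (n + 1)).choose 2 + (n + s + 1) * s) =
        Q ^ ((n + s + 1).choose 2 + (n + s + 1) ^ 2 + (n + 1).choose 2) := by
      congr 1
      have h1 := choose_two_add (n + s + 1) (n + 1)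
      linarith
    rw [← pow_mul]
    rw [pow_add (-u) (n + s + 1) (n + 1), neg_pow u (n + 1)]
    linear_combination (gaussBinom Q s (n + s + 1 + (n + 1)) * (-u) ^ (n + s + 1) *
      ((-1) ^ (n + 1) * u ^ (n + 1))) * e

/-- Jacobi's triple product identity modulo `q ^ (N + 1)`, for `u`, `v`, `Q` divisible by `q`:
there every Gaussian binomial in the finite form becomes the inverse of `qPoch Q N`. The finite form
is a hypothesis because the ring here is not a domain; it holds for images of elements of one. -/
theorem jacobi_triple_product_of_finite {q Q u v : R} {N : ℕ} (hq : q ^ (N + 1) = 0)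
    (hQ : q ∣ Q) (hu : q ∣ u) (hv : q ∣ v)
    (h : (∏ j ∈ range N, (1 - u * Q ^ j)) * ∏ j ∈ range N, (1 - v * Q ^ j) =
      ∑ n ∈ range (N + 1),
        (-1) ^ n * Q ^ n.choose 2 * v ^ n * gaussBinom Q (N + n) (N - n) +
      ∑ n ∈ range N,
        (-1) ^ (n + 1) * Q ^ (n + 1).choose 2 * u ^ (n + 1) *
          gaussBinom Q (N - (n + 1)) (N + (n + 1))) :
    (∏ j ∈ range N, (1 - u * Q ^ j)) * (∏ j ∈ range N, (1 - v * Q ^ j)) * qPoch Q N =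
      ∑ n ∈ range (N + 1), ((-1) ^ n * Q ^ n.choose 2 * v ^ n +
        (-1) ^ (n + 1) * Q ^ (n + 1).choose 2 * u ^ (n + 1)) := by
  have hQn : IsNilpotent Q := by
    obtain ⟨r, rfl⟩ := hQ
    exact ⟨N + 1, by rw [mul_pow, hq, zero_mul]⟩
  -- The estimate `n.choose 2 + n + (N - n + 1) ≥ N + 1` for the error terms.
  have hz : ∀ w : R, q ∣ w → ∀ n ≤ N,
      (-1) ^ n * Q ^ n.choose 2 * w ^ n * Q ^ (N - n + 1) = 0 := by
    intro w hw n hn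
    have h1 : q ^ (n + (N - n + 1)) ∣ w ^ n * Q ^ (N - n + 1) := by
      rw [pow_add]
      exact mul_dvd_mul (pow_dvd_pow_of_dvd hw _) (pow_dvd_pow_of_dvd hQ _)
    rw [show n + (N - n + 1) = N + 1 by omega, hq, zero_dvd_iff] at h1
    rw [mul_assoc, h1, mul_zero]
  rw [h, add_mul, sum_mul, sum_mul, sum_add_distrib]
  congr 1
  · refine sum_congr rfl fun n hn => ?_
    have hn' : n ≤ N := Nat.lt_succ_iff.1 (mem_range.1 hn)
    rw [mul_assoc]
    exact mul_gaussBinom_mul_qPoch_eq hQn (e := N - n) (by omega) le_rfl (by omega)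
      (hz v hv n hn')
  · have hlast : u ^ (N + 1) = 0 := by
      have := pow_dvd_pow_of_dvd hu (N + 1)
      rwa [hq, zero_dvd_iff] at this
    rw [sum_range_succ, hlast, mul_zero, add_zero]
    refine sum_congr rfl fun n hn => ?_
    have hn' : n + 1 ≤ N := mem_range.1 hn
    rw [mul_assoc]
    exact mul_gaussBinom_mul_qPoch_eq hQn (e := N - (n + 1)) le_rfl (by omega) (by omega)
      (hz u hu (n + 1) hn')

end JacobiTripleProduct

/-! ### The Rogers–Selberg series and its recurrence -/

section RogersSelberg

variable {R : Type*} [CommRing R]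

/-- The sum of the first `T` terms of the Rogers–Selberg series with parameters `k`, `i`,
specialised at `x = q ^ m`, where its coefficients `(x q; q)ₙ / (q; q)ₙ` are Gaussian binomials.
It is used for `i ≤ k` only. -/
def rogersSelberg (q : R) (k T m i : ℕ) : R :=
  ∑ n ∈ range T, (-1) ^ n * q ^ (k * m * n + (n + 1).choose 2 + k * n ^ 2 + (k - i) * n) *
    (1 - q ^ (i * (m + 2 * n + 1))) * gaussBinom q n m

@[simp]
lemma rogersSelberg_zero_right (q : R) (k T m : ℕ) : rogersSelberg q k T m 0 = 0 := by
  simp [rogersSelberg]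

/-- The Rogers–Selberg recurrence. The difference on the left splits into two sums; after a shift
of the first of them by one term, they combine into the series on the right. -/
theorem rogersSelberg_succ {q : R} {k T m i : ℕ} (hq : q ^ T = 0) (hik : i < k) :
    rogersSelberg q k T m (i + 1) = rogersSelberg q k T m i +
      q ^ ((m + 1) * i) * (1 - q ^ (m + 1)) * rogersSelberg q k T (m + 1) (k - i) := by
  have hn : IsNilpotent q := ⟨T, hq⟩
  obtain ⟨e, rfl⟩ := Nat.exists_eq_add_of_lt hik
  let a : ℕ → R := fun n => (-1) ^ n *
    q ^ ((i + e + 1) * m * n + (n + 1).choose 2 + (i + e + 1) * n ^ 2 + e * n) *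
      (1 - q ^ n) * gaussBinom q n m
  let b : ℕ → R := fun n => (-1) ^ n *
    q ^ ((i + e + 1) * m * n + (n + 1).choose 2 + (i + e + 1) * n ^ 2 + (i + e + 1) * n +
      i * (m + n + 1)) * (1 - q ^ (m + n + 1)) * gaussBinom q n m
  have h1 : rogersSelberg q (i + e + 1) T m (i + 1) - rogersSelberg q (i + e + 1) T m i =
      ∑ n ∈ range T, a n + ∑ n ∈ range T, b n := by
    rw [rogersSelberg, rogersSelberg, ← sum_sub_distrib, ← sum_add_distrib]
    refine sum_congr rfl fun n _ => ?_
    simp only [a, b, show i + e + 1 - (i + 1) = e by omega, show i + e + 1 - i = e + 1 by omega]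
    ring
  have haT : a T = 0 := by
    have hle : T ≤ (i + e + 1) * m * T + (T + 1).choose 2 + (i + e + 1) * T ^ 2 + e * T := by
      nlinarith [Nat.zero_le (T.choose 2), two_mul_choose_two_add T,
        Nat.zero_le ((i + e) * T ^ 2), Nat.zero_le ((i + e + 1) * m * T), Nat.zero_le (e * T),
        Nat.zero_le ((T + 1).choose 2), Nat.le_self_pow (two_ne_zero) T]
    simp only [a]
    rw [pow_eq_zero_of_le hle hq]
    ring
  have ha0 : a 0 = 0 := by simp [a]
  have hshift : ∑ n ∈ range T, a n = ∑ n ∈ range T, a (n + 1) := by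
    have := sum_range_succ' a T
    rw [sum_range_succ, haT, ha0] at this
    simpa using this
  have h2 : ∑ n ∈ range T, a (n + 1) + ∑ n ∈ range T, b n =
      q ^ ((m + 1) * i) * (1 - q ^ (m + 1)) *
        rogersSelberg q (i + e + 1) T (m + 1) (i + e + 1 - i) := by
    rw [rogersSelberg, mul_sum, ← sum_add_distrib]
    refine sum_congr rfl fun n _ => ?_
    have g1 := one_sub_mul_gaussBinom_succ_left hn n m
    have g2 := one_sub_mul_gaussBinom_succ_right hn n m
    simp only [a, b, show i + e + 1 - i = e + 1 by omega,
      show i + e + 1 - (e + 1) = i by omega]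
    have c2 : (n + 1 + 1).choose 2 = (n + 1).choose 2 + (n + 1) := by
      rw [Nat.choose_succ_succ' (n + 1) 1, Nat.choose_one_right, add_comm]
    rw [c2]
    generalize (n + 1).choose 2 = c
    rw [show m + n + 1 = n + m + 1 by ring]
    linear_combination
      (-1) ^ (n + 1) * q ^ ((i + e + 1) * m * (n + 1) + (c + (n + 1)) +
        (i + e + 1) * (n + 1) ^ 2 + e * (n + 1)) * g1 -
      q ^ ((m + 1) * i) * (-1) ^ n * q ^ ((i + e + 1) * (m + 1) * n + c +
        (i + e + 1) * n ^ 2 + i * n) * (1 - q ^ ((e + 1) * (m + 1 + 2 * n + 1))) * g2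
  linear_combination h1 + hshift + h2

lemma rogersSelberg_of_le {q : R} {k N m i : ℕ} (hq : q ^ (N + 1) = 0) (hm : N ≤ m)
    (hi : 1 ≤ i) (hik : i ≤ k) : rogersSelberg q k (N + 1) m i = 1 := by
  rw [rogersSelberg, sum_range_succ', sum_eq_zero]
  · have : N + 1 ≤ i * (m + 1) := by nlinarith
    simp [pow_eq_zero_of_le this hq]
  · intro n _
    have : N + 1 ≤ k * m * (n + 1) + (n + 1 + 1).choose 2 + k * (n + 1) ^ 2 +
        (k - i) * (n + 1) := by
      have h1 : 1 * N ≤ k * m := Nat.mul_le_mul (by omega) hm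
      have h2 : k * m * 1 ≤ k * m * (n + 1) := Nat.mul_le_mul_left _ (by omega)
      have h3 : 0 < (n + 1 + 1).choose 2 := Nat.choose_pos (by omega)
      omega
    rw [pow_eq_zero_of_le this hq]
    ring

/-- Uniqueness of the solution of the Rogers–Selberg recurrence: modulo `q ^ (N + 1)`, a family
`F m i` with `F m (i + 1) - F m i = q ^ ((m + 1) * i) * F (m + 1) (k - i)` and with value `r` at
`m = N` is a multiple of the Rogers–Selberg series, by descending induction on `m`. -/
theorem mul_prod_eq_mul_rogersSelberg {q r : R} {k N : ℕ} (hq : q ^ (N + 1) = 0)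
    (F : ℕ → ℕ → R) (h0 : ∀ m, F m 0 = 0) (hN : ∀ i, 1 ≤ i → F N i = r)
    (hF : ∀ m i, i < k → F m (i + 1) = F m i + q ^ ((m + 1) * i) * F (m + 1) (k - i))
    (t m : ℕ) (hm : m + t = N) (i : ℕ) (hik : i ≤ k) :
    F m i * ∏ l ∈ range t, (1 - q ^ (m + l + 1)) = r * rogersSelberg q k (N + 1) m i := by
  induction t generalizing m i with
  | zero =>
    obtain rfl : m = N := by omega
    obtain rfl | hi := Nat.eq_zero_or_pos i
    · simp [h0]
    · simp [hN i hi, rogersSelberg_of_le hq le_rfl hi hik]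
  | succ t ih =>
    induction i with
    | zero => simp [h0]
    | succ i ihi =>
      have h1 := ih (m + 1) (by omega) (k - i) (by omega)
      have h2 := ihi (by omega)
      have h3 : ∏ l ∈ range (t + 1), (1 - q ^ (m + l + 1)) =
          (1 - q ^ (m + 1)) * ∏ l ∈ range t, (1 - q ^ (m + 1 + l + 1)) := by
        rw [prod_range_succ', mul_comm]
        congr 1
        exact prod_congr rfl fun l _ => by rw [show m + (l + 1) + 1 = m + 1 + l + 1 by ring]
      rw [rogersSelberg_succ hq (by omega), hF m i (by omega)]
      rw [h3] at h2 ⊢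
      linear_combination h2 + q ^ ((m + 1) * i) * (1 - q ^ (m + 1)) * h1

/-- At `x = 1` the Rogers–Selberg series is the theta series of Jacobi's triple product with base
`q ^ (2 * k + 1)`. -/
theorem rogersSelberg_zero_eq_theta (q : R) {k i : ℕ} (hik : i ≤ k) (T : ℕ) :
    rogersSelberg q k T 0 i =
      ∑ n ∈ range T, ((-1) ^ n * (q ^ (2 * k + 1)) ^ n.choose 2 * (q ^ (2 * k + 1 - i)) ^ n +
        (-1) ^ (n + 1) * (q ^ (2 * k + 1)) ^ (n + 1).choose 2 * (q ^ i) ^ (n + 1)) := by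
  rw [rogersSelberg]
  refine sum_congr rfl fun n _ => ?_
  obtain ⟨e, rfl⟩ := Nat.exists_eq_add_of_le hik
  rw [show i + e - i = e by omega, show 2 * (i + e) + 1 - i = i + 2 * e + 1 by omega,
    show (n + 1).choose 2 = n.choose 2 + n by
      rw [Nat.choose_succ_succ' n 1, Nat.choose_one_right, add_comm]]
  have h := two_mul_choose_two_add n
  have e1 : (i + e) * 0 * n + (n.choose 2 + n) + (i + e) * n ^ 2 + e * n =
      (2 * (i + e) + 1) * n.choose 2 + (i + 2 * e + 1) * n := by
    rw [← h]
    ring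
  have e2 : (i + e) * 0 * n + (n.choose 2 + n) + (i + e) * n ^ 2 + e * n +
      i * (0 + 2 * n + 1) = (2 * (i + e) + 1) * (n.choose 2 + n) + i * (n + 1) := by
    rw [← h]
    ring
  have e3 := congrArg (q ^ ·) e1
  have e4 := congrArg (q ^ ·) e2
  simp only [pow_add _ _ (i * (0 + 2 * n + 1))] at e3 e4
  rw [gaussBinom_zero_right, mul_one]
  linear_combination (-1) ^ n * e3 - (-1) ^ n * e4

end RogersSelberg

open PowerSeries

/-! ### Generating functions of partitions -/

section PartitionGenFun

open Classical in
/-- The generating function, with integer coefficients, of the partitions whose multiset of parts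
satisfies `P`. -/
noncomputable def partitionGenFun (P : Multiset ℕ → Prop) : ℤ⟦X⟧ :=
  PowerSeries.mk fun n => ((univ.filter fun π : n.Partition => P π.parts).card : ℤ)

lemma coeff_partitionGenFun (P : Multiset ℕ → Prop) [DecidablePred P] (n : ℕ) :
    coeff n (partitionGenFun P) = ((univ.filter fun π : n.Partition => P π.parts).card : ℤ) := by
  rw [partitionGenFun, coeff_mk]
  congr!

lemma coeff_partitionGenFun_congr {P P' : Multiset ℕ → Prop} {n : ℕ}
    (h : ∀ π : n.Partition, P π.parts ↔ P' π.parts) :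
    coeff n (partitionGenFun P) = coeff n (partitionGenFun P') := by
  classical
  rw [coeff_partitionGenFun, coeff_partitionGenFun]
  congr 2
  exact filter_congr fun π _ => h π

lemma partitionGenFun_congr {P P' : Multiset ℕ → Prop} (h : ∀ s, P s ↔ P' s) :
    partitionGenFun P = partitionGenFun P' := by
  ext n
  exact coeff_partitionGenFun_congr fun π => h _

lemma partitionGenFun_eq_zero {P : Multiset ℕ → Prop} (h : ∀ s, ¬ P s) :
    partitionGenFun P = 0 := by
  classical
  ext n
  simp [coeff_partitionGenFun, h]

lemma partitionGenFun_and_add_and_not (P D : Multiset ℕ → Prop) :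
    partitionGenFun (fun s => P s ∧ D s) + partitionGenFun (fun s => P s ∧ ¬ D s) =
      partitionGenFun P := by
  classical
  ext n
  have h := card_filter_add_card_filter_not
    (s := univ.filter fun π : n.Partition => P π.parts) (fun π => D π.parts)
  rw [filter_filter, filter_filter] at h
  rw [map_add, coeff_partitionGenFun, coeff_partitionGenFun, coeff_partitionGenFun]
  exact_mod_cast h

/-- Removing `e` copies of the part `a` from partitions that contain at least `e` of them. -/
lemma partitionGenFun_eq_X_pow_mul {P : Multiset ℕ → Prop} {a e : ℕ} (ha : 0 < a)
    (h : ∀ s, P s → e ≤ s.count a) :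
    partitionGenFun P =
      X ^ (a * e) * partitionGenFun (fun s => P (s + Multiset.replicate e a)) := by
  classical
  ext n
  rw [coeff_X_pow_mul', coeff_partitionGenFun]
  have hle : ∀ π : n.Partition, P π.parts → Multiset.replicate e a ≤ π.parts := fun π hπ =>
    Multiset.le_count_iff_replicate_le.1 (h _ hπ)
  split_ifs with hn
  · rw [coeff_partitionGenFun]
    congr 1
    symm
    refine card_bij (fun π _ => ⟨π.parts + Multiset.replicate e a, ?_, ?_⟩) ?_ ?_ ?_
    · intro i hi
      rcases Multiset.mem_add.1 hi with hi | hi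
      · exact π.parts_pos hi
      · rwa [Multiset.eq_of_mem_replicate hi]
    · rw [Multiset.sum_add, π.parts_sum, Multiset.sum_replicate, smul_eq_mul, mul_comm e a]
      omega
    · intro π hπ
      simpa using hπ
    · intro π _ π' _ hππ
      ext1
      simpa using congrArg Nat.Partition.parts hππ
    · intro π hπ
      have hP : P π.parts := by simpa using hπ
      have hs := tsub_add_cancel_of_le (hle π hP)
      refine ⟨⟨π.parts - Multiset.replicate e a, ?_, ?_⟩, ?_, ?_⟩
      · intro i hi
        exact π.parts_pos (Multiset.mem_of_le tsub_le_self hi)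
      · have := congrArg Multiset.sum hs
        rw [Multiset.sum_add, π.parts_sum, Multiset.sum_replicate, smul_eq_mul, mul_comm e a]
          at this
        omega
      · simpa [hs] using hP
      · ext1
        exact hs
  · rw [Nat.cast_eq_zero, card_eq_zero, filter_eq_empty_iff]
    intro π _ hπ
    obtain ⟨t, ht⟩ := Multiset.le_iff_exists_add.1 (hle π hπ)
    have := congrArg Multiset.sum ht
    rw [Multiset.sum_add, π.parts_sum, Multiset.sum_replicate, smul_eq_mul, mul_comm e a] at this
    omega

/-- `(1 - X ^ (L + 1))` removes the partitions that contain the part `L + 1`. -/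
lemma one_sub_X_pow_mul_partitionGenFun (p : ℕ → Prop) (L : ℕ) (hL : p (L + 1)) :
    (1 - X ^ (L + 1)) * partitionGenFun (fun s => ∀ a ∈ s, p a ∧ L < a) =
      partitionGenFun (fun s => ∀ a ∈ s, p a ∧ L + 1 < a) := by
  have h1 := partitionGenFun_and_add_and_not (fun s => ∀ a ∈ s, p a ∧ L < a) (fun s => L + 1 ∈ s)
  have h2 := partitionGenFun_eq_X_pow_mul (P := fun s => (∀ a ∈ s, p a ∧ L < a) ∧ L + 1 ∈ s)
    (a := L + 1) (e := 1) (by omega) fun s hs => Multiset.one_le_count_iff_mem.2 hs.2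
  have h3 : partitionGenFun (fun s => (fun s => (∀ a ∈ s, p a ∧ L < a) ∧ L + 1 ∈ s)
      (s + Multiset.replicate 1 (L + 1))) = partitionGenFun (fun s => ∀ a ∈ s, p a ∧ L < a) := by
    refine partitionGenFun_congr fun s => ?_
    simp only [Multiset.replicate_one, Multiset.mem_add, Multiset.mem_singleton]
    constructor
    · exact fun h a ha => h.1 a (Or.inl ha)
    · refine fun h => ⟨?_, Or.inr trivial⟩
      rintro a (ha | rfl)
      · exact h a ha
      · exact ⟨hL, by omega⟩
  have h4 : partitionGenFun (fun s => (∀ a ∈ s, p a ∧ L < a) ∧ ¬ L + 1 ∈ s) =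
      partitionGenFun (fun s => ∀ a ∈ s, p a ∧ L + 1 < a) := by
    refine partitionGenFun_congr fun s => ⟨fun h a ha => ?_, fun h => ⟨fun a ha => ?_, fun h' => ?_⟩⟩
    · have := h.1 a ha
      have hne : a ≠ L + 1 := fun e => h.2 (e ▸ ha)
      exact ⟨this.1, by omega⟩
    · exact ⟨(h a ha).1, by have := (h a ha).2; omega⟩
    · have := (h _ h').2
      omega
  rw [h3, mul_one] at h2
  rw [h2, h4] at h1
  linear_combination -h1

open Classical in
/-- The product of `1 - x ^ j` over those `1 ≤ j ≤ N` that satisfy `p`. -/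
noncomputable def eulerProd {R : Type*} [CommRing R] (x : R) (N : ℕ) (p : ℕ → Prop) : R :=
  ∏ j ∈ Icc 1 N, if p j then 1 - x ^ j else 1

lemma map_eulerProd {R S : Type*} [CommRing R] [CommRing S] (φ : R →+* S) (x : R) (N : ℕ)
    (p : ℕ → Prop) : φ (eulerProd x N p) = eulerProd (φ x) N p := by
  simp [eulerProd, apply_ite φ]

lemma partitionGenFun_mul_eulerProd (p : ℕ → Prop) (L : ℕ) :
    partitionGenFun (fun s => ∀ a ∈ s, p a ∧ 0 < a) * eulerProd X L p =
      partitionGenFun (fun s => ∀ a ∈ s, p a ∧ L < a) := by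
  induction L with
  | zero => simp [eulerProd]
  | succ L ih =>
    rw [eulerProd, prod_Icc_succ_top (by omega), ← mul_assoc]
    rw [eulerProd] at ih
    rw [ih]
    split_ifs with hL
    · rw [mul_comm, one_sub_X_pow_mul_partitionGenFun p L hL]
    · rw [mul_one]
      refine partitionGenFun_congr fun s => forall₂_congr fun a _ => and_congr_right fun ha => ?_
      have : a ≠ L + 1 := fun e => hL (e ▸ ha)
      omega

/-- The partitions into parts exceeding `N`: only the empty one is a partition of some `n ≤ N`. -/
lemma coeff_partitionGenFun_parts_gt (p : ℕ → Prop) {n N : ℕ} (hn : n ≤ N) :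
    coeff n (partitionGenFun (fun s => ∀ a ∈ s, p a ∧ N < a)) = coeff n (1 : ℤ⟦X⟧) := by
  classical
  rw [coeff_partitionGenFun, coeff_one]
  split_ifs with h
  · subst h
    rw [filter_true_of_mem]
    · simp
    · intro π _ a ha
      have := π.parts_pos ha
      have := π.le_of_mem_parts ha
      omega
  · rw [Nat.cast_eq_zero, card_eq_zero, filter_eq_empty_iff]
    intro π _ hπ
    obtain ⟨a, ha⟩ : ∃ a, a ∈ π.parts := by
      by_contra! hne
      have := π.parts_sum
      rw [Multiset.eq_zero_of_forall_notMem hne] at this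
      exact h (by simpa using this.symm)
    have := π.le_of_mem_parts ha
    have := (hπ a ha).2
    omega

end PartitionGenFun

/-! ### The recurrence for Gordon-type partitions -/

section GordonRecurrence

/-- The multiset `s` satisfies the conditions of the Gordon-type partitions on the multiples of
`d`, with every `d * j` for `1 ≤ j ≤ m` excluded, and with fewer than `i` copies of the first
admitted multiple `d * (m + 1)`. Strict bounds make the value `i = 0` meaningful: it admits
nothing. -/
def IsGordonAbove (d k m i : ℕ) (s : Multiset ℕ) : Prop :=
  (∀ j, 1 ≤ j → j ≤ m → s.count (d * j) = 0) ∧ s.count (d * (m + 1)) < i ∧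
    ∀ j, m + 1 ≤ j → s.count (d * j) + s.count (d * j + d) < k

/-- Sorting by whether `d * (m + 1)` has exactly `i` copies, and removing these copies. -/
lemma partitionGenFun_isGordonAbove_succ {d k m i : ℕ} (hd : 1 ≤ d) (hik : i < k) :
    partitionGenFun (IsGordonAbove d k m (i + 1)) = partitionGenFun (IsGordonAbove d k m i) +
      (X ^ d) ^ ((m + 1) * i) * partitionGenFun (IsGordonAbove d k (m + 1) (k - i)) := by
  have hinj : ∀ {a b : ℕ}, d * a = d * b → a = b := fun h => Nat.eq_of_mul_eq_mul_left hd h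
  have h1 := partitionGenFun_and_add_and_not (IsGordonAbove d k m (i + 1))
    (fun s => s.count (d * (m + 1)) = i)
  have h2 := partitionGenFun_eq_X_pow_mul
    (P := fun s => IsGordonAbove d k m (i + 1) s ∧ s.count (d * (m + 1)) = i)
    (a := d * (m + 1)) (e := i) (by positivity) fun s hs => hs.2.ge
  have h3 : partitionGenFun (fun s => (fun s => IsGordonAbove d k m (i + 1) s ∧
      s.count (d * (m + 1)) = i) (s + Multiset.replicate i (d * (m + 1)))) =
      partitionGenFun (IsGordonAbove d k (m + 1) (k - i)) := by
    refine partitionGenFun_congr fun s => ?_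
    have hc : ∀ j, (s + Multiset.replicate i (d * (m + 1))).count (d * j) =
        s.count (d * j) + if j = m + 1 then i else 0 := by
      intro j
      rw [Multiset.count_add, Multiset.count_replicate]
      congr 1
      by_cases hj : j = m + 1
      · simp [hj]
      · rw [if_neg hj, if_neg fun h => hj (hinj h).symm]
    have hd1 : ∀ j, d * j + d = d * (j + 1) := fun j => by ring
    simp only [IsGordonAbove, hd1, hc]
    constructor
    · rintro ⟨⟨ha, -, hb⟩, hc'⟩
      simp only [if_true] at hc'
      refine ⟨fun j hj hjm => ?_, ?_, fun j hj => ?_⟩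
      · obtain rfl | hne := eq_or_ne j (m + 1)
        · omega
        · have := ha j hj (by omega)
          omega
      · have := hb (m + 1) le_rfl
        simp only [if_true] at this
        rw [if_neg (by omega)] at this
        omega
      · have := hb j (by omega)
        rw [if_neg (by omega), if_neg (by omega)] at this
        omega
    · rintro ⟨ha, hb, hc'⟩
      have h0 := ha (m + 1) (by omega) le_rfl
      refine ⟨⟨fun j hj hjm => ?_, ?_, fun j hj => ?_⟩, ?_⟩
      · rw [if_neg (by omega), ha j hj (by omega)]
      · rw [if_pos trivial]
        omega
      · rw [if_neg (c := j + 1 = m + 1) (by omega)]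
        obtain rfl | hne := eq_or_ne j (m + 1)
        · rw [if_pos rfl]
          omega
        · have := hc' j (by omega)
          rw [if_neg hne]
          omega
      · rw [if_pos trivial]
        omega
  have h4 : partitionGenFun (fun s => IsGordonAbove d k m (i + 1) s ∧
      ¬ s.count (d * (m + 1)) = i) = partitionGenFun (IsGordonAbove d k m i) := by
    refine partitionGenFun_congr fun s => ⟨fun h => ?_, fun h => ?_⟩
    · exact ⟨h.1.1, by have := h.1.2.1; have := h.2; omega, h.1.2.2⟩
    · exact ⟨⟨h.1, by have := h.2.1; omega, h.2.2⟩, h.2.1.ne⟩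
  rw [h3] at h2
  rw [h2, h4] at h1
  rw [← h1, ← pow_mul, mul_assoc d]
  ring

/-- With all multiples of `d` up to `d * N` excluded, no multiple of `d` is left for `n ≤ N`. -/
lemma coeff_partitionGenFun_isGordonAbove {d k i n N : ℕ} (hd : 1 ≤ d) (hk : 1 ≤ k) (hi : 1 ≤ i)
    (hn : n ≤ N) :
    coeff n (partitionGenFun (IsGordonAbove d k N i)) =
      coeff n (partitionGenFun (fun s => ∀ a ∈ s, ¬ d ∣ a ∧ 0 < a)) := by
  refine coeff_partitionGenFun_congr fun π => ⟨fun h a ha => ⟨?_, π.parts_pos ha⟩, fun h => ?_⟩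
  · rintro ⟨j, rfl⟩
    have h1 := π.parts_pos ha
    have h2 := π.le_of_mem_parts ha
    have h3 : j ≤ d * j := Nat.le_mul_of_pos_left j hd
    exact Multiset.count_ne_zero.2 ha
      (h.1 j (Nat.pos_of_ne_zero (by rintro rfl; simp at h1)) (by omega))
  · have h0 : ∀ j, π.parts.count (d * j) = 0 := fun j =>
      Multiset.count_eq_zero.2 fun hj => (h _ hj).1 (dvd_mul_right d j)
    refine ⟨fun j _ _ => h0 j, by rw [h0]; exact hi, fun j _ => ?_⟩
    rw [show d * j + d = d * (j + 1) by ring, h0, h0]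
    exact hk

end GordonRecurrence

/-! ### Products of `1 - x ^ j` in a truncated ring -/

section EulerProducts

variable {R : Type*} [CommRing R]

lemma eulerProd_mul_eulerProd (x : R) (N : ℕ) {p p' r : ℕ → Prop}
    (hr : ∀ j, 1 ≤ j → (r j ↔ p j ∨ p' j)) (hd : ∀ j, 1 ≤ j → p j → ¬ p' j) :
    eulerProd x N p * eulerProd x N p' = eulerProd x N r := by
  rw [eulerProd, eulerProd, eulerProd, ← prod_mul_distrib]
  refine prod_congr rfl fun j hj => ?_
  have h1 := hr j (mem_Icc.1 hj).1
  have h2 := hd j (mem_Icc.1 hj).1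
  by_cases hp : p j <;> by_cases hp' : p' j <;> simp_all

lemma isUnit_eulerProd {x : R} (hx : IsNilpotent x) (N : ℕ) (p : ℕ → Prop) :
    IsUnit (eulerProd x N p) := by
  refine IsUnit.prod_iff.2 fun j hj => ?_
  split_ifs
  · exact (hx.pow_of_pos (by have := (mem_Icc.1 hj).1; omega)).isUnit_one_sub
  · exact isUnit_one

/-- Modulo `x ^ (N + 1)`, the product over a progression `f 0, f 1, …` may be cut off at any
length that covers its terms up to `N`. -/
lemma prod_one_sub_eq_eulerProd {x : R} {N : ℕ} (hx : x ^ (N + 1) = 0) {f : ℕ → ℕ}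
    (hf : StrictMono f) (hf0 : 1 ≤ f 0) {p : ℕ → Prop}
    (hp : ∀ a, 1 ≤ a → (p a ↔ ∃ j, f j = a)) :
    ∏ j ∈ range N, (1 - x ^ f j) = eulerProd x N p := by
  classical
  have hle : ∀ j, j + 1 ≤ f j := by
    intro j
    induction j with
    | zero => exact hf0
    | succ j ih => have := hf j.lt_add_one; omega
  rw [eulerProd, ← prod_filter, ← prod_image (f := fun a => 1 - x ^ a) (g := f) hf.injective.injOn]
  symm
  refine prod_subset (fun a ha => ?_) (fun a ha hna => ?_)
  · simp only [mem_filter, mem_Icc] at ha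
    obtain ⟨j, rfl⟩ := (hp a ha.1.1).1 ha.2
    exact mem_image_of_mem f (mem_range.2 (by have := hle j; omega))
  · obtain ⟨j, -, rfl⟩ := mem_image.1 ha
    have h1 := hle j
    have : N + 1 ≤ f j := by
      by_contra hlt
      exact hna (mem_filter.2 ⟨mem_Icc.2 ⟨by omega, by omega⟩, (hp _ (by omega)).2 ⟨j, rfl⟩⟩)
    rw [pow_eq_zero_of_le this hx, sub_zero]

end EulerProducts

/-! ### Comparison of the two generating functions -/

section Assembly

lemma quotient_mk_eq_iff {N : ℕ} {f g : ℤ⟦X⟧} :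
    Ideal.Quotient.mk (Ideal.span {(X : ℤ⟦X⟧) ^ (N + 1)}) f =
      Ideal.Quotient.mk (Ideal.span {(X : ℤ⟦X⟧) ^ (N + 1)}) g ↔
      ∀ n ≤ N, coeff n f = coeff n g := by
  rw [Ideal.Quotient.eq, Ideal.mem_span_singleton, X_pow_dvd_iff]
  simp only [map_sub, sub_eq_zero, Nat.lt_succ_iff]

lemma quotient_mk_X_pow (N : ℕ) :
    Ideal.Quotient.mk (Ideal.span {(X : ℤ⟦X⟧) ^ (N + 1)}) X ^ (N + 1) = 0 := by
  rw [← map_pow, Ideal.Quotient.eq_zero_iff_mem]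
  exact Ideal.mem_span_singleton_self _

/-- The parts that the partitions counted by `numA d k i` avoid. -/
def IsExcludedPart (d k i a : ℕ) : Prop :=
  (∃ j, d * ((2 * k + 1) * (j + 1)) = a) ∨ (∃ j, d * (i + (2 * k + 1) * j) = a) ∨
    ∃ j, d * (2 * k + 1 - i + (2 * k + 1) * j) = a

lemma not_modEq_iff_not_isExcludedPart {d k i a : ℕ} (hi : 1 ≤ i) (hik : i ≤ k) (ha : 1 ≤ a) :
    (¬ (a : ℤ) ≡ 0 [ZMOD 2 * d * k + d] ∧ ¬ (a : ℤ) ≡ (d : ℤ) * i [ZMOD 2 * d * k + d] ∧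
      ¬ (a : ℤ) ≡ -((d : ℤ) * i) [ZMOD 2 * d * k + d]) ↔ ¬ IsExcludedPart d k i a := by
  have hM : (2 * d * k + d : ℤ) = d * (2 * k + 1) := by ring
  -- Since `0 < a` and `r ≤ 2 * k`, the multiplier `c` in `a = d * r + d * (2 * k + 1) * c` cannot
  -- be negative.
  have hres : ∀ r : ℕ, r ≤ 2 * k →
      ((a : ℤ) ≡ d * r [ZMOD 2 * d * k + d] ↔ ∃ j, d * (r + (2 * k + 1) * j) = a) := by
    intro r hr
    rw [Int.modEq_comm, Int.modEq_iff_dvd, hM]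
    constructor
    · rintro ⟨c, hc⟩
      have hc' : (a : ℤ) = d * (r + (2 * k + 1) * c) := by linear_combination hc
      have hc0 : 0 ≤ c := by
        by_contra! hneg
        have h1 : (r : ℤ) + (2 * k + 1) * c ≤ 0 := by nlinarith
        have h2 : (d : ℤ) * (r + (2 * k + 1) * c) ≤ 0 :=
          mul_nonpos_of_nonneg_of_nonpos (by positivity) h1
        omega
      obtain ⟨j, rfl⟩ := Int.eq_ofNat_of_zero_le hc0
      exact ⟨j, by exact_mod_cast hc'.symm⟩
    · rintro ⟨j, rfl⟩
      exact ⟨j, by push_cast; ring⟩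
  have h0 : (a : ℤ) ≡ 0 [ZMOD 2 * d * k + d] ↔ ∃ j, d * ((2 * k + 1) * (j + 1)) = a := by
    have := hres 0 (by omega)
    rw [Nat.cast_zero, mul_zero] at this
    rw [this]
    constructor
    · rintro ⟨j, hj⟩
      obtain ⟨j, rfl⟩ : ∃ t, j = t + 1 :=
        Nat.exists_eq_add_one_of_ne_zero (by rintro rfl; simp at hj; omega)
      exact ⟨j, by rw [← hj, zero_add]⟩
    · rintro ⟨j, hj⟩
      exact ⟨j + 1, by rw [← hj, zero_add]⟩
  have h2 : (a : ℤ) ≡ -((d : ℤ) * i) [ZMOD 2 * d * k + d] ↔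
      ∃ j, d * (2 * k + 1 - i + (2 * k + 1) * j) = a := by
    rw [← hres (2 * k + 1 - i) (by omega), Nat.cast_sub (by omega)]
    have h : (d : ℤ) * (((2 * k + 1 : ℕ) : ℤ) - i) = -((d : ℤ) * i) + (2 * d * k + d) := by
      push_cast
      ring
    rw [h]
    constructor
    · exact fun h => h.trans (Int.add_modEq_right.symm)
    · exact fun h => h.trans Int.add_modEq_right
  rw [h0, hres i (by omega), h2, IsExcludedPart]
  tauto

/-- Jacobi's triple product evaluates the theta series as the product over the excluded parts. -/
lemma rogersSelberg_zero_eq_eulerProd {d k i N : ℕ} (hd : 1 ≤ d) (hi : 1 ≤ i) (hik : i ≤ k) :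
    rogersSelberg (Ideal.Quotient.mk (Ideal.span {(X : ℤ⟦X⟧) ^ (N + 1)}) X ^ d) k (N + 1) 0 i =
      eulerProd (Ideal.Quotient.mk (Ideal.span {(X : ℤ⟦X⟧) ^ (N + 1)}) X) N
        (IsExcludedPart d k i) := by
  have hx := quotient_mk_X_pow N
  have hfin := finite_jacobi_triple_product (R := ℤ⟦X⟧) (Q := (X ^ d) ^ (2 * k + 1))
    (u := (X ^ d) ^ i) (v := (X ^ d) ^ (2 * k + 1 - i))
    (by rw [← pow_add]; congr 1; omega) (pow_ne_zero _ (pow_ne_zero _ X_ne_zero)) N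
  replace hfin := congrArg (Ideal.Quotient.mk (Ideal.span {(X : ℤ⟦X⟧) ^ (N + 1)})) hfin
  simp only [map_mul, map_prod, map_sum, map_add, map_sub, map_one, map_pow, map_neg,
    map_gaussBinom] at hfin
  generalize Ideal.Quotient.mk (Ideal.span {(X : ℤ⟦X⟧) ^ (N + 1)}) X = x at hx hfin ⊢
  have hq : (x ^ d) ^ (N + 1) = 0 := by
    rw [← pow_mul, mul_comm, pow_mul, hx, zero_pow (by omega)]
  rw [rogersSelberg_zero_eq_theta _ hik,
    ← jacobi_triple_product_of_finite hq (dvd_pow_self _ (by omega)) (dvd_pow_self _ (by omega))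
      (dvd_pow_self _ (by omega)) hfin, qPoch]
  have hmono : ∀ r, StrictMono fun j => d * (r + (2 * k + 1) * j) := fun r a b hab => by
    have : (2 * k + 1) * a < (2 * k + 1) * b := Nat.mul_lt_mul_of_pos_left hab (by omega)
    exact Nat.mul_lt_mul_of_pos_left (by omega) hd
  have p1 := prod_one_sub_eq_eulerProd hx (hmono i)
    (Nat.mul_pos hd (by omega)) (p := fun a => ∃ j, d * (i + (2 * k + 1) * j) = a)
    fun a _ => Iff.rfl
  have p2 := prod_one_sub_eq_eulerProd hx (hmono (2 * k + 1 - i))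
    (Nat.mul_pos hd (by omega)) (p := fun a => ∃ j, d * (2 * k + 1 - i + (2 * k + 1) * j) = a)
    fun a _ => Iff.rfl
  have p0 := prod_one_sub_eq_eulerProd hx (f := fun j => d * ((2 * k + 1) * (j + 1)))
    (by simpa [mul_add, add_comm] using hmono (2 * k + 1))
    (Nat.mul_pos hd (by omega)) (p := fun a => ∃ j, d * ((2 * k + 1) * (j + 1)) = a)
    fun a _ => Iff.rfl
  have hmod : ∀ r j, r < 2 * k + 1 → (r + (2 * k + 1) * j) % (2 * k + 1) = r := fun r j hr => by
    rw [Nat.add_mul_mod_self_left, Nat.mod_eq_of_lt hr]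
  have hcancel : ∀ {a b : ℕ}, d * a = d * b → a % (2 * k + 1) = b % (2 * k + 1) := fun h => by
    rw [Nat.eq_of_mul_eq_mul_left hd h]
  have m1 := eulerProd_mul_eulerProd x N
    (p := fun a => ∃ j, d * (i + (2 * k + 1) * j) = a)
    (p' := fun a => ∃ j, d * (2 * k + 1 - i + (2 * k + 1) * j) = a)
    (fun _ _ => Iff.rfl) (by
      rintro _ - ⟨j, rfl⟩ ⟨j', hj'⟩
      have := hcancel hj'
      rw [hmod _ _ (by omega), hmod _ _ (by omega)] at this
      omega)
  have m2 := eulerProd_mul_eulerProd x N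
    (p := fun a => ∃ j, d * ((2 * k + 1) * (j + 1)) = a)
    (p' := fun a => (∃ j, d * (i + (2 * k + 1) * j) = a) ∨
      ∃ j, d * (2 * k + 1 - i + (2 * k + 1) * j) = a)
    (r := IsExcludedPart d k i)
    (fun _ _ => Iff.rfl) (by
      rintro _ - ⟨j, rfl⟩ (⟨j', hj'⟩ | ⟨j', hj'⟩)
      all_goals
        have := hcancel hj'
        rw [hmod _ _ (by omega), Nat.mul_mod_right] at this
        omega)
  rw [← m2, ← m1, ← p0, ← p1, ← p2, mul_comm]
  congr 1
  · exact prod_congr rfl fun j _ => by rw [← pow_mul, ← pow_mul]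
  · congr 1 <;> exact prod_congr rfl fun j _ => by
      rw [mul_add d, pow_add x, pow_mul x d, pow_mul x d, pow_mul (x ^ d)]

/-- The analytic form of the theorem, modulo `X ^ (N + 1)`: both generating functions become `1`
after multiplication with the product of `1 - X ^ a` over the admitted parts `a`. -/
theorem coeff_partitionGenFun_isGordonAbove_eq {d k i n : ℕ} (hd : 1 ≤ d) (hi : 1 ≤ i)
    (hik : i ≤ k) :
    coeff n (partitionGenFun (IsGordonAbove d k 0 i)) =
      coeff n (partitionGenFun (fun s => ∀ a ∈ s, ¬ IsExcludedPart d k i a ∧ 0 < a)) := by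
  let φ := Ideal.Quotient.mk (Ideal.span {(X : ℤ⟦X⟧) ^ (n + 1)})
  refine quotient_mk_eq_iff.1 ?_ n le_rfl
  have hx : φ X ^ (n + 1) = 0 := quotient_mk_X_pow n
  have hxn : IsNilpotent (φ X) := ⟨_, hx⟩
  have hq : (φ X ^ d) ^ (n + 1) = 0 := by
    rw [← pow_mul, mul_comm, pow_mul, hx, zero_pow (by omega)]
  have hone : ∀ p : ℕ → Prop, φ (partitionGenFun (fun s => ∀ a ∈ s, p a ∧ 0 < a)) *
      eulerProd (φ X) n p = 1 := by
    intro p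
    rw [← map_eulerProd, ← map_mul, partitionGenFun_mul_eulerProd, ← map_one φ]
    exact quotient_mk_eq_iff.2 fun j hj => coeff_partitionGenFun_parts_gt p hj
  -- `r` generates the partitions without multiples of `d`.
  have hmain := mul_prod_eq_mul_rogersSelberg hq (k := k)
    (r := φ (partitionGenFun (fun s => ∀ a ∈ s, ¬ d ∣ a ∧ 0 < a)))
    (fun m i => φ (partitionGenFun (IsGordonAbove d k m i)))
    (fun m => by
      rw [partitionGenFun_eq_zero fun s h => absurd h.2.1 (Nat.not_lt_zero _), map_zero])
    (fun i hi => quotient_mk_eq_iff.2 fun j hj =>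
      coeff_partitionGenFun_isGordonAbove hd (by omega) hi hj)
    (fun m i hik => by
      rw [partitionGenFun_isGordonAbove_succ hd hik, map_add, map_mul, map_pow, map_pow])
    n 0 (by omega) i hik
  have hmult : ∏ l ∈ range n, (1 - (φ X ^ d) ^ (0 + l + 1)) = eulerProd (φ X) n (d ∣ ·) := by
    rw [← prod_one_sub_eq_eulerProd hx (f := fun j => d * (j + 1))
      (fun a b hab => Nat.mul_lt_mul_of_pos_left (by omega) hd) (by simpa using hd)
      fun a ha => ?_]
    · exact prod_congr rfl fun l _ => by rw [← pow_mul, zero_add]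
    · constructor
      · rintro ⟨j, rfl⟩
        obtain ⟨j, rfl⟩ : ∃ t, j = t + 1 :=
          Nat.exists_eq_add_one_of_ne_zero (by rintro rfl; simp at ha)
        exact ⟨j, rfl⟩
      · rintro ⟨j, rfl⟩
        exact dvd_mul_right _ _
  have hexcl : ∀ a, IsExcludedPart d k i a → d ∣ a := by
    rintro _ (⟨j, rfl⟩ | ⟨j, rfl⟩ | ⟨j, rfl⟩) <;> exact dvd_mul_right _ _
  have s1 := eulerProd_mul_eulerProd (φ X) n (p := IsExcludedPart d k i)
    (p' := fun a => d ∣ a ∧ ¬ IsExcludedPart d k i a) (r := (d ∣ ·))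
    (fun a _ => by have := hexcl a; tauto) (fun a _ h h' => h'.2 h)
  have s2 := eulerProd_mul_eulerProd (φ X) n (p := fun a => ¬ d ∣ a)
    (p' := fun a => d ∣ a ∧ ¬ IsExcludedPart d k i a) (r := fun a => ¬ IsExcludedPart d k i a)
    (fun a _ => by have := hexcl a; tauto) (fun a _ h h' => h h'.1)
  have hA := hone fun a => ¬ IsExcludedPart d k i a
  have hR := hone fun a => ¬ d ∣ a
  have hB : φ (partitionGenFun (IsGordonAbove d k 0 i)) *
      eulerProd (φ X) n (fun a => d ∣ a ∧ ¬ IsExcludedPart d k i a) =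
      φ (partitionGenFun (fun s => ∀ a ∈ s, ¬ d ∣ a ∧ 0 < a)) := by
    apply (isUnit_eulerProd hxn n (IsExcludedPart d k i)).mul_right_cancel
    have hS : rogersSelberg (φ X ^ d) k (n + 1) 0 i = _ :=
      rogersSelberg_zero_eq_eulerProd hd hi hik
    rw [hmult, hS, ← s1] at hmain
    linear_combination hmain
  apply (isUnit_eulerProd hxn n (fun a => ¬ IsExcludedPart d k i a)).mul_right_cancel
  change φ _ * _ = φ _ * _
  rw [hA, ← s2]
  linear_combination eulerProd (φ X) n (fun a => ¬ d ∣ a) * hB + hR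

end Assembly

theorem theorem1 (d k i n : ℕ) (hd : 1 ≤ d) (hi : 1 ≤ i) (hik : i ≤ k) :
    numA d k i n = numB d k i n := by
  classical
  have hA : (numA d k i n : ℤ) =
      coeff n (partitionGenFun (fun s => ∀ a ∈ s, ¬ IsExcludedPart d k i a ∧ 0 < a)) := by
    rw [coeff_partitionGenFun, numA, Nat.Partition.restricted]
    congr 2
    refine filter_congr fun π _ => forall₂_congr fun a ha => ?_
    have h0 := π.parts_pos ha
    rw [not_modEq_iff_not_isExcludedPart hi hik h0]
    exact (and_iff_left h0).symm
  have hB : (numB d k i n : ℤ) = coeff n (partitionGenFun (IsGordonAbove d k 0 i)) := by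
    rw [coeff_partitionGenFun, numB]
    congr 2
    refine filter_congr fun π _ => ?_
    rw [IsGordonPartition, IsGordonAbove, zero_add, mul_one]
    constructor
    · rintro ⟨h1, h2⟩
      exact ⟨fun j hj hj0 => by omega, by omega, fun j hj => by have := h2 j hj; omega⟩
    · rintro ⟨-, h1, h2⟩
      exact ⟨by omega, fun j hj => by have := h2 j hj; omega⟩
  have h := coeff_partitionGenFun_isGordonAbove_eq (n := n) hd hi hik
  rw [← hA, ← hB] at h
  exact_mod_cast h.symm
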